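/- For a real polynomial $f(t)$ and integers $0\le i<r$, let $f^{\langle r,0\rangle},\dots,f^{\langle r,r-1\rangle}\in\mathbb{R}[t]$ be the unique polynomials with $f(t)=\sum_{i=0}^{r-1}t^i f^{\langle r,i\rangle}(t^r)$. For real-rooted $f,g\in\mathbb{R}[t]$ with roots (counted with multiplicity) $s_1\ge s_2\ge\cdots\ge s_k$ and $t_1\ge t_2\ge\cdots\ge t_m$ write $f\preceq g$ if $\cdots\le s_2\le t_2\le s_1\le t_1$, where $m\in\{k,k+1\}$; nonzero constants are real-rooted (with no roots), the zero polynomial is regarded as real-rooted, and $0\preceq f$ and $f\preceq 0$ for every real-rooted $f$. A sequence $(f_1,\dots,f_m)$ of polynomials is an interlacing sequence if $f_i\preceq f_j$ whenever $i\le j$. Lemma. Let $h(t)\in\mathbb{R}[t]$ and, for integers $0\le i<r$ and $d\ge 0$, let $$a_{h,d}^{\langle r,i\rangle}:=\bigl(h(t)(1+t+\cdots+t^{r-1})^d\bigr)^{\langle r,i\rangle}.$$ Then, for all $0\le i<r$ and $d\ge 0$, $$a_{h,d+1}^{\langle r,i\rangle}=a_{h,d}^{\langle r,0\rangle}+a_{h,d}^{\langle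 r,1\rangle}+\cdots+a_{h,d}^{\langle r,i\rangle}+t\,a_{h,d}^{\langle r,i+1\rangle}+\cdots+t\,a_{h,d}^{\langle r,r-1\rangle}.$$ Moreover, if $h(t)$ has only nonnegative coefficients and degree $s$, then for all integers $r\ge\max\{s,1\}$ and $d\ge 0$ $$\bigl(a_{h,d}^{\langle r,r-1\rangle},a_{h,d}^{\langle r,r-2\rangle},\dots,a_{h,d}^{\langle r,0\rangle}\bigr)$$ is an interlacing sequence. (This holds also for $h=0$.) -/

import Mathlib

open Polynomial

noncomputable section

/-- The part `f^⟨r,i⟩` of a real polynomial `f` (for `0 ≤ i < r`): its `n`-th coefficient is the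
`(r n + i)`-th coefficient of `f`. Equivalently, these are the unique polynomials with
`f(t) = ∑_{i < r} t^i f^⟨r,i⟩(t^r)`; see `sum_veronesePart` and `veronesePart_unique`. -/
def veronesePart (r i : ℕ) (f : ℝ[X]) : ℝ[X] :=
  ∑ n ∈ Finset.range (f.natDegree + 1), monomial n (f.coeff (r * n + i))

theorem coeff_veronesePart {r : ℕ} (hr : 0 < r) (i n : ℕ) (f : ℝ[X]) :
    (veronesePart r i f).coeff n = f.coeff (r * n + i) := by
  simp only [veronesePart, finsetSum_coeff, coeff_monomial, Finset.sum_ite_eq',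
    Finset.mem_range]
  split_ifs with h
  · rfl
  · refine (coeff_eq_zero_of_natDegree_lt ?_).symm
    have : n ≤ r * n := Nat.le_mul_of_pos_left n hr
    omega

theorem coeff_sum_expand {r : ℕ} (hr : 0 < r) (g : ℕ → ℝ[X]) (n i : ℕ) (hi : i < r) :
    (∑ j ∈ Finset.range r, X ^ j * expand ℝ r (g j)).coeff (r * n + i) = (g i).coeff n := by
  rw [finsetSum_coeff, Finset.sum_eq_single i]
  · rw [add_comm (r * n) i, add_comm i, coeff_X_pow_mul, coeff_expand hr]
    simp [Nat.mul_div_cancel_left n hr]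
  · intro j hj hji
    rw [Finset.mem_range] at hj
    rw [coeff_X_pow_mul']
    split_ifs with hle
    · rw [coeff_expand hr, if_neg]
      rintro ⟨k, hk⟩
      have h1 : r * n + i = r * k + j := by omega
      have h2 := congrArg (· % r) h1
      simp only [Nat.mul_add_mod, Nat.mod_eq_of_lt hi, Nat.mod_eq_of_lt hj] at h2
      exact hji h2.symm
    · rfl
  · intro h
    exact absurd (Finset.mem_range.mpr hi) h

/-- `f(t) = ∑_{i < r} t^i f^⟨r,i⟩(t^r)`. -/
theorem sum_veronesePart {r : ℕ} (hr : 0 < r) (f : ℝ[X]) :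
    ∑ i ∈ Finset.range r, X ^ i * expand ℝ r (veronesePart r i f) = f := by
  ext m
  have h := coeff_sum_expand hr (fun i => veronesePart r i f) (m / r) (m % r) (Nat.mod_lt m hr)
  rw [coeff_veronesePart hr, Nat.div_add_mod] at h
  exact h

/-- The decomposition `f(t) = ∑_{i < r} t^i g_i(t^r)` determines the `g_i`. -/
theorem veronesePart_unique {r : ℕ} (hr : 0 < r) (f : ℝ[X]) (g : ℕ → ℝ[X])
    (hg : ∑ i ∈ Finset.range r, X ^ i * expand ℝ r (g i) = f) (i : ℕ) (hi : i < r) :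
    g i = veronesePart r i f := by
  ext n
  rw [coeff_veronesePart hr, ← hg, coeff_sum_expand hr g n i hi]

/-- `a_{h,d}^⟨r,i⟩ = (h(t) (1 + t + ⋯ + t^{r-1})^d)^⟨r,i⟩`. -/
def aPoly (h : ℝ[X]) (d r i : ℕ) : ℝ[X] :=
  veronesePart r i (h * (∑ j ∈ Finset.range r, X ^ j) ^ d)

/-- A real polynomial is real-rooted if it is a product of real polynomials of degree at most one,
i.e. if all its complex zeros are real. The zero polynomial is included. -/
def RealRooted (f : ℝ[X]) : Prop := f.Splits

/-- The roots of a real polynomial with multiplicity, in weakly decreasing order. -/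
def rootsDesc (f : ℝ[X]) : List ℝ := f.roots.sort (· ≥ ·)

/-- `f ⪯ g`: both are real-rooted and the roots `s₁ ≥ s₂ ≥ ⋯` of `f` and `t₁ ≥ t₂ ≥ ⋯` of `g`
satisfy `⋯ ≤ s₂ ≤ t₂ ≤ s₁ ≤ t₁` (so that `g` has as many roots as `f`, or one more); by convention
`0 ⪯ f` and `f ⪯ 0` for every real-rooted `f`. -/
def Interlaces (f g : ℝ[X]) : Prop :=
  RealRooted f ∧ RealRooted g ∧
    (f = 0 ∨ g = 0 ∨
      (((rootsDesc g).length = (rootsDesc f).length ∨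
          (rootsDesc g).length = (rootsDesc f).length + 1) ∧
        (∀ (k : ℕ) (hf : k < (rootsDesc f).length) (hg : k < (rootsDesc g).length),
          (rootsDesc f)[k] ≤ (rootsDesc g)[k]) ∧
        (∀ (k : ℕ) (hf : k < (rootsDesc f).length) (hg : k + 1 < (rootsDesc g).length),
          (rootsDesc g)[k + 1] ≤ (rootsDesc f)[k])))

/-- `(f_1, …, f_m)` is an interlacing sequence if `f_i ⪯ f_j` whenever `i ≤ j`. -/
def IsInterlacingSequence {m : ℕ} (f : Fin m → ℝ[X]) : Prop :=
  ∀ i j : Fin m, i ≤ j → Interlaces (f i) (f j)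

end

/-! Fix `z` in the open upper half plane. Interlacing is encoded by angles: the values at `z` of the
listed parts satisfy `ArgBetween z` for every pair, that is, they turn counterclockwise and by at
most `arg z`. For `d = 0` the condition `deg h ≤ r` makes every part a nonnegative constant except
the 0-th, which is linear. The recurrence preserves the angular order (`ArgBetween.step`), so it
holds for all `d`. The order also excludes cancellation, so a nonzero part never vanishes in the
upper half plane; by conjugation it is real-rooted. Finally, `Im (f(z) * conj (g(z))) ≤ 0`
throughout the upper half plane traps the difference of continuous arguments in `[0, π]`. Its limit
at a real non-root `x` is `π` times the difference of the numbers of roots above `x`. Hence these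
counts differ by 0 or 1, which is interlacing. -/

/-! ### The recurrence in `d` and nonnegativity of coefficients. -/

theorem coeff_mul_sum_X_pow (F : ℝ[X]) (r m : ℕ) :
    (F * ∑ j ∈ Finset.range r, X ^ j).coeff m =
      ∑ j ∈ Finset.range r, if j ≤ m then F.coeff (m - j) else 0 := by
  simp [Finset.mul_sum, finsetSum_coeff, coeff_mul_X_pow']

theorem aPoly_succ (h : ℝ[X]) {r d i : ℕ} (hi : i < r) :
    aPoly h (d + 1) r i =
      ∑ j ∈ Finset.range (i + 1), aPoly h d r j +
        ∑ j ∈ Finset.Ico (i + 1) r, X * aPoly h d r j := by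
  have hr : 0 < r := by omega
  unfold aPoly
  rw [pow_succ, ← mul_assoc]
  generalize h * (∑ j ∈ Finset.range r, X ^ j) ^ d = F
  ext n
  rw [coeff_veronesePart hr, coeff_mul_sum_X_pow, coeff_add, finsetSum_coeff, finsetSum_coeff,
    ← Finset.sum_range_add_sum_Ico _ (show i + 1 ≤ r by omega)]
  congr 1
  · refine Finset.sum_nbij' (fun j => i - j) (fun j => i - j) ?_ ?_ ?_ ?_ ?_
    all_goals simp only [Finset.mem_range]
    · intro j hj; omega
    · intro j hj; omega
    · intro j hj; omega
    · intro j hj; omega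
    · intro j hj
      rw [if_pos (by omega), coeff_veronesePart hr]
      congr 1; omega
  -- For `j > i` the subtraction borrows: `r(n+1) + i - j = rn + (r + i - j)`. This borrow is the
  -- factor `X`.
  · refine Finset.sum_nbij' (fun j => r + i - j) (fun j => r + i - j) ?_ ?_ ?_ ?_ ?_
    all_goals simp only [Finset.mem_Ico]
    · intro j hj; omega
    · intro j hj; omega
    · intro j hj; omega
    · intro j hj; omega
    · intro j hj
      cases n with
      | zero => rw [if_neg (by omega), coeff_X_mul_zero]
      | succ n =>
        have e : r * (n + 1) = r * n + r := by ring
        rw [if_pos (by omega), coeff_X_mul, coeff_veronesePart hr]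
        congr 1; omega

theorem coeff_aPoly_nonneg {h : ℝ[X]} (hh : ∀ n, 0 ≤ h.coeff n) {r : ℕ} (hr : 0 < r) (d i n : ℕ) :
    0 ≤ (aPoly h d r i).coeff n := by
  rw [aPoly, coeff_veronesePart hr]
  generalize r * n + i = m
  induction d generalizing m with
  | zero => simpa using hh m
  | succ d ih =>
    rw [pow_succ, ← mul_assoc, coeff_mul_sum_X_pow]
    refine Finset.sum_nonneg fun j _ => ?_
    split_ifs
    · exact ih _
    · exact le_rfl

/-! ### Angular order of complex numbers. -/

/-- For `z` in the upper half plane: going counterclockwise from the ray of `a`, one meets the ray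
of `b` at an angle between `0` and `arg z`. -/
def ArgBetween (z a b : ℂ) : Prop :=
  (a * starRingEnd ℂ b).im ≤ 0 ∧ (b * starRingEnd ℂ (z * a)).im ≤ 0

theorem ArgBetween.refl {z : ℂ} (hz : 0 < z.im) (a : ℂ) : ArgBetween z a a := by
  constructor
  · simp [Complex.mul_im]; linarith
  · simp [Complex.mul_im]; nlinarith [sq_nonneg a.re, sq_nonneg a.im]

/-- Both conditions are real-bilinear in the pair, so they may be summed over all pairs. -/
theorem ArgBetween.sum {z : ℂ} {s t : Finset ℕ} {u v : ℕ → ℂ}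
    (H : ∀ i ∈ s, ∀ j ∈ t, ArgBetween z (u i) (v j)) :
    ArgBetween z (∑ i ∈ s, u i) (∑ j ∈ t, v j) := by
  constructor
  · rw [map_sum, Finset.sum_mul_sum, Complex.im_sum]
    refine Finset.sum_nonpos fun i hi => ?_
    rw [Complex.im_sum]
    exact Finset.sum_nonpos fun j hj => (H i hi j hj).1
  · rw [Finset.mul_sum, map_sum, Finset.sum_mul_sum, Complex.im_sum]
    refine Finset.sum_nonpos fun j hj => ?_
    rw [Complex.im_sum]
    exact Finset.sum_nonpos fun i hi => (H i hi j hj).2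

/-- No relation between `A` and `C` is needed: in the first condition their cross terms cancel, in
the second they are absorbed into `z * A + C` paired with itself. -/
theorem ArgBetween.step {z A B C : ℂ} (hz : 0 < z.im) (hAB : ArgBetween z A B)
    (hBC : ArgBetween z B C) :
    ArgBetween z (C + B + z * A) (C + z * (B + A)) := by
  have hn : 0 ≤ Complex.normSq z := Complex.normSq_nonneg z
  have h1 := mul_nonpos_of_nonneg_of_nonpos hn hAB.1
  have h2 := mul_nonpos_of_nonneg_of_nonpos hn hAB.2
  have h3 := mul_nonpos_of_nonneg_of_nonpos hn hBC.1
  have h4 := (ArgBetween.refl hz B).2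
  have h5 := (ArgBetween.refl hz (z * A + C)).2
  obtain ⟨hAB1, hAB2⟩ := hAB
  obtain ⟨hBC1, hBC2⟩ := hBC
  constructor
  · have e : ((C + B + z * A) * starRingEnd ℂ (C + z * (B + A))).im =
        Complex.normSq z * (A * starRingEnd ℂ B).im + (B * starRingEnd ℂ (z * A)).im +
        (B * starRingEnd ℂ (z * B)).im + (B * starRingEnd ℂ C).im +
        (C * starRingEnd ℂ (z * B)).im := by
      simp [Complex.normSq_apply]; ring
    linarith
  · have e : ((C + z * (B + A)) * starRingEnd ℂ (z * (C + B + z * A))).im =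
        ((z * A + C) * starRingEnd ℂ (z * (z * A + C))).im +
        Complex.normSq z * (A * starRingEnd ℂ B).im +
        Complex.normSq z * (B * starRingEnd ℂ (z * A)).im +
        Complex.normSq z * (B * starRingEnd ℂ C).im +
        (C * starRingEnd ℂ (z * B)).im := by
      simp [Complex.normSq_apply]; ring
    linarith

/-- Opposite nonzero vectors are at angle `π`, which exceeds `arg z`. -/
theorem ArgBetween.eq_zero_of_add_eq_zero {z a b : ℂ} (hz : 0 < z.im) (H : ArgBetween z a b)
    (h : a + b = 0) : a = 0 ∧ b = 0 := by
  have hb : b = -a := by linear_combination h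
  subst hb
  have h2 := H.2
  have e : (-a * starRingEnd ℂ (z * a)).im = z.im * Complex.normSq a := by
    simp [Complex.normSq_apply]; ring
  rw [e] at h2
  have h3 : Complex.normSq a = 0 := by
    nlinarith [Complex.normSq_nonneg a]
  have := Complex.normSq_eq_zero.1 h3
  simp [this]

theorem ArgBetween.eq_zero_of_add_mul_eq_zero {z a b : ℂ} (hz : 0 < z.im) (H : ArgBetween z a b)
    (h : b + z * a = 0) : a = 0 ∧ b = 0 := by
  have hb : b = -(z * a) := by linear_combination h
  subst hb
  have h2 := H.1
  have e : (a * starRingEnd ℂ (-(z * a))).im = z.im * Complex.normSq a := by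
    simp [Complex.normSq_apply]; ring
  rw [e] at h2
  have h3 : Complex.normSq a = 0 := by
    nlinarith [Complex.normSq_nonneg a]
  have := Complex.normSq_eq_zero.1 h3
  simp [this]

theorem eq_zero_of_sum_Ico_eq_zero {z : ℂ} (hz : 0 < z.im) {v : ℕ → ℂ} {a b : ℕ}
    (H : ∀ i j, i ≤ j → j < b → ArgBetween z (v j) (v i))
    (h : ∑ j ∈ Finset.Ico a b, v j = 0) : ∀ j ∈ Finset.Ico a b, v j = 0 := by
  induction b with
  | zero => simp
  | succ b ih =>
    intro j hj
    have hab : a ≤ b := by rw [Finset.mem_Ico] at hj; omega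
    rw [Finset.sum_Ico_succ_top hab, add_comm] at h
    have S : ArgBetween z (v b) (∑ j ∈ Finset.Ico a b, v j) := by
      have := ArgBetween.sum (z := z) (s := {b}) (t := Finset.Ico a b) (u := v) (v := v)
        fun i hi j hj => by
          rw [Finset.mem_singleton] at hi
          rw [Finset.mem_Ico] at hj
          subst hi
          exact H j i (by omega) (by omega)
      simpa using this
    obtain ⟨h1, h2⟩ := S.eq_zero_of_add_eq_zero hz h
    rw [Finset.mem_Ico] at hj
    rcases Nat.lt_succ_iff_lt_or_eq.1 hj.2 with h3 | h3
    · exact ih (fun i j hij hj => H i j hij (by omega)) h2 j (Finset.mem_Ico.2 ⟨hj.1, h3⟩)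
    · rw [h3, h1]

/-! ### Values of the parts in the upper half plane. -/

theorem aeval_aPoly_succ (h : ℝ[X]) (z : ℂ) {r d i : ℕ} (hi : i < r) :
    aeval z (aPoly h (d + 1) r i) =
      ∑ j ∈ Finset.range (i + 1), aeval z (aPoly h d r j) +
        z * ∑ j ∈ Finset.Ico (i + 1) r, aeval z (aPoly h d r j) := by
  rw [aPoly_succ h hi]
  simp [Finset.mul_sum]

theorem aPoly_zero_of_pos {h : ℝ[X]} {r i : ℕ} (hr : h.natDegree ≤ r) (hi : 0 < i) (hir : i < r) :
    aPoly h 0 r i = C (h.coeff i) := by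
  ext n
  rw [aPoly, coeff_veronesePart (by omega), pow_zero, mul_one, coeff_C]
  split_ifs with hn
  · simp [hn]
  · refine coeff_eq_zero_of_natDegree_lt ?_
    have : r * 1 ≤ r * n := Nat.mul_le_mul_left r (by omega)
    omega

theorem aPoly_zero_zero {h : ℝ[X]} {r : ℕ} (hr : h.natDegree ≤ r) (hr1 : 0 < r) :
    aPoly h 0 r 0 = C (h.coeff 0) + C (h.coeff r) * X := by
  ext n
  rw [aPoly, coeff_veronesePart hr1, pow_zero, mul_one, add_zero]
  match n with
  | 0 => simp
  | 1 => simp [coeff_C]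
  | n + 2 =>
    have : r * (n + 2) = r * n + r + r := by ring
    rw [coeff_eq_zero_of_natDegree_lt (by omega)]
    simp

theorem argBetween_aPoly {h : ℝ[X]} (hh : ∀ n, 0 ≤ h.coeff n) {r : ℕ} (hr : h.natDegree ≤ r)
    {z : ℂ} (hz : 0 < z.im) (d : ℕ) : ∀ i j, i ≤ j → j < r →
      ArgBetween z (aeval z (aPoly h d r j)) (aeval z (aPoly h d r i)) := by
  induction d with
  | zero =>
    intro i j hij hj
    rcases hij.eq_or_lt with rfl | hij
    · exact ArgBetween.refl hz _
    rw [aPoly_zero_of_pos hr (by omega) hj]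
    rcases Nat.eq_zero_or_pos i with rfl | hi
    · rw [aPoly_zero_zero hr (by omega)]
      have h1 := mul_nonneg (mul_nonneg (hh j) (hh r)) hz.le
      have h2 := mul_nonneg (mul_nonneg (hh j) (hh 0)) hz.le
      constructor
      · simp; linarith
      · simp; linarith
    · rw [aPoly_zero_of_pos hr hi (by omega)]
      have h1 := mul_nonneg (mul_nonneg (hh j) (hh i)) hz.le
      constructor
      · simp
      · simp; linarith
  | succ d ih =>
    intro i j hij hj
    rw [aeval_aPoly_succ h z hj, aeval_aPoly_succ h z (by omega : i < r),
      ← Finset.sum_range_add_sum_Ico _ (show i + 1 ≤ j + 1 by omega),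
      ← Finset.sum_Ico_consecutive _ (show i + 1 ≤ j + 1 by omega) (show j + 1 ≤ r by omega)]
    apply ArgBetween.step hz
    all_goals
      apply ArgBetween.sum
      intro k hk l hl
      simp only [Finset.mem_Ico, Finset.mem_range] at hk hl
      exact ih _ _ (by omega) (by omega)

/-- If a part at level `d + 1` vanishes at `z`, the angular order forces every part at level `d` to
vanish there; by induction those are zero polynomials, hence so is the new part. -/
theorem aPoly_eq_zero_or_aeval_ne_zero {h : ℝ[X]} (hh : ∀ n, 0 ≤ h.coeff n) {r : ℕ}
    (hr : h.natDegree ≤ r) {z : ℂ} (hz : 0 < z.im) (d : ℕ) : ∀ i < r,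
      aPoly h d r i = 0 ∨ aeval z (aPoly h d r i) ≠ 0 := by
  induction d with
  | zero =>
    intro i hi
    rw [or_iff_not_imp_right, not_not]
    rcases Nat.eq_zero_or_pos i with rfl | hi0
    · rw [aPoly_zero_zero hr hi]
      intro H
      have him := congrArg Complex.im H
      have hre := congrArg Complex.re H
      simp at him hre
      have h1 : h.coeff r = 0 := him.resolve_right hz.ne'
      rw [h1] at hre ⊢
      have h0 : h.coeff 0 = 0 := by simpa using hre
      simp [h0]
    · rw [aPoly_zero_of_pos hr hi0 hi]
      intro H
      have : h.coeff i = 0 := by simpa using H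
      simp [this]
  | succ d ih =>
    intro i hi
    rw [or_iff_not_imp_right, not_not, aeval_aPoly_succ h z hi]
    intro H
    have S := argBetween_aPoly hh hr hz d
    have S2 : ArgBetween z (∑ j ∈ Finset.Ico (i + 1) r, aeval z (aPoly h d r j))
        (∑ j ∈ Finset.range (i + 1), aeval z (aPoly h d r j)) := by
      apply ArgBetween.sum
      intro k hk l hl
      simp only [Finset.mem_Ico, Finset.mem_range] at hk hl
      exact S _ _ (by omega) (by omega)
    obtain ⟨h1, h2⟩ := S2.eq_zero_of_add_mul_eq_zero hz H
    rw [Finset.range_eq_Ico] at h2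
    have h1' := eq_zero_of_sum_Ico_eq_zero hz S h1
    have h2' := eq_zero_of_sum_Ico_eq_zero hz (fun i j h h' => S i j h (by omega)) h2
    have key : ∀ j < r, aPoly h d r j = 0 := by
      intro j hj
      refine (ih j hj).resolve_right (not_not.2 ?_)
      rcases lt_or_ge j (i + 1) with h3 | h3
      · exact h2' j (Finset.mem_Ico.2 ⟨by omega, h3⟩)
      · exact h1' j (Finset.mem_Ico.2 ⟨h3, hj⟩)
    rw [aPoly_succ h hi, Finset.sum_eq_zero, Finset.sum_eq_zero, add_zero]
    · intro j hj
      rw [Finset.mem_Ico] at hj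
      rw [key j (by omega), mul_zero]
    · intro j hj
      rw [Finset.mem_range] at hj
      exact key j (by omega)

/-! ### Real-rootedness and root counts from arguments. -/

theorem realRooted_of_aeval_ne_zero {f : ℝ[X]} (hf : f ≠ 0)
    (H : ∀ z : ℂ, 0 < z.im → aeval z f ≠ 0) : RealRooted f := by
  have H' : ∀ z : ℂ, aeval z f = 0 → z.im = 0 := by
    intro z hz
    rcases lt_trichotomy z.im 0 with h | h | h
    · refine absurd ?_ (H (starRingEnd ℂ z) (by simpa using h))
      rw [aeval_conj, hz, map_zero]
    · exact h
    · exact absurd hz (H z h)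
  refine (IsAlgClosed.splits (f.map (algebraMap ℝ ℂ))).of_splits_map (algebraMap ℝ ℂ) ?_
  intro z hz
  rw [mem_roots (map_ne_zero hf), IsRoot.def, eval_map_algebraMap] at hz
  exact ⟨z.re, Complex.ext rfl (by simpa using (H' z hz).symm)⟩

/-- The sum of the arguments of `z - a`, for `a` in the multiset `s`. -/
noncomputable def argSum (s : Multiset ℝ) (z : ℂ) : ℝ := (s.map fun a : ℝ => (z - a).arg).sum

theorem prod_sub_eq_norm_mul_exp (s : Multiset ℝ) (z : ℂ) :
    (s.map fun a : ℝ => z - a).prod =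
      ‖(s.map fun a : ℝ => z - a).prod‖ * Complex.exp (argSum s z * Complex.I) := by
  induction s using Multiset.induction_on with
  | empty => simp [argSum]
  | cons a s ih =>
    have e : argSum (a ::ₘ s) z = (z - a).arg + argSum s z := by simp [argSum]
    rw [e, Multiset.map_cons, Multiset.prod_cons, norm_mul, Complex.ofReal_add, add_mul,
      Complex.exp_add, Complex.ofReal_mul]
    have h := Complex.norm_mul_exp_arg_mul_I (z - a)
    conv_lhs => rw [ih, ← h]
    ring

theorem continuousOn_argSum (s : Multiset ℝ) : ContinuousOn (argSum s) {z : ℂ | 0 < z.im} := by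
  induction s using Multiset.induction_on with
  | empty =>
    have : argSum 0 = fun _ => 0 := by ext; simp [argSum]
    rw [this]
    exact continuousOn_const
  | cons a s ih =>
    have e : argSum (a ::ₘ s) = fun z : ℂ => (z - a).arg + argSum s z := by ext; simp [argSum]
    rw [e]
    refine ContinuousOn.add (fun z hz => ContinuousAt.continuousWithinAt ?_) ih
    refine ContinuousAt.comp (f := fun z : ℂ => z - a) (g := Complex.arg)
      (Complex.continuousAt_arg (Or.inr ?_)) (by fun_prop)
    simpa using (ne_of_gt hz : z.im ≠ 0)

/-- `arg` jumps across the negative axis but is continuous there from above, so the approach stays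
in the closed upper half plane. -/
theorem tendsto_arg_ofReal_add_mul_I {x : ℝ} (hx : x ≠ 0) :
    Filter.Tendsto (fun y : ℝ => ((x : ℂ) + y * Complex.I).arg) (nhdsWithin 0 (Set.Ioi 0))
      (nhds (if x < 0 then Real.pi else 0)) := by
  have hpath : Filter.Tendsto (fun y : ℝ => (x : ℂ) + y * Complex.I) (nhdsWithin 0 (Set.Ioi 0))
      (nhdsWithin (x : ℂ) {z | 0 ≤ z.im}) := by
    refine tendsto_nhdsWithin_iff.2 ⟨?_, ?_⟩
    · have : Continuous fun y : ℝ => (x : ℂ) + y * Complex.I := by fun_prop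
      have h := this.tendsto 0
      simp only [Complex.ofReal_zero, zero_mul, add_zero] at h
      exact h.mono_left nhdsWithin_le_nhds
    · filter_upwards [self_mem_nhdsWithin] with y hy
      simpa using (le_of_lt hy : 0 ≤ y)
  have h : ContinuousWithinAt Complex.arg {z | 0 ≤ z.im} (x : ℂ) := by
    rcases hx.lt_or_gt with h | h
    · exact Complex.continuousWithinAt_arg_of_re_neg_of_im_zero (by simpa using h) (by simp)
    · exact (Complex.continuousAt_arg (Or.inl (by simpa using h))).continuousWithinAt
  have e : (x : ℂ).arg = if x < 0 then Real.pi else 0 := by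
    split_ifs with h
    · exact Complex.arg_ofReal_of_neg h
    · exact Complex.arg_ofReal_of_nonneg (not_lt.1 h)
  rw [← e]
  exact h.tendsto.comp hpath

theorem tendsto_argSum {s : Multiset ℝ} {x : ℝ} (hx : x ∉ s) :
    Filter.Tendsto (fun y : ℝ => argSum s ((x : ℂ) + y * Complex.I)) (nhdsWithin 0 (Set.Ioi 0))
      (nhds (Real.pi * (s.countP (x < ·) : ℕ))) := by
  induction s using Multiset.induction_on with
  | empty => simp [argSum]
  | cons a s ih =>
    rw [Multiset.mem_cons, not_or] at hx
    have h := (tendsto_arg_ofReal_add_mul_I (sub_ne_zero.2 hx.1)).add (ih hx.2)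
    have e : (fun y : ℝ => argSum (a ::ₘ s) ((x : ℂ) + y * Complex.I)) = fun y : ℝ =>
        (((x - a : ℝ) : ℂ) + y * Complex.I).arg + argSum s ((x : ℂ) + y * Complex.I) := by
      ext y
      simp only [argSum, Multiset.map_cons, Multiset.sum_cons]
      congr 2
      push_cast; ring
    rw [e]
    convert h using 2
    rw [Multiset.countP_cons]
    simp only [sub_neg]
    split_ifs <;> push_cast <;> ring

theorem countP_roots_of_im_nonpos {s t : Multiset ℝ}
    (H : ∀ z : ℂ, 0 < z.im → ((s.map fun a : ℝ => z - a).prod *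
      starRingEnd ℂ (t.map fun a : ℝ => z - a).prod).im ≤ 0)
    {x : ℝ} (hs : x ∉ s) (ht : x ∉ t) :
    s.countP (x < ·) ≤ t.countP (x < ·) ∧ t.countP (x < ·) ≤ s.countP (x < ·) + 1 := by
  have hpi := Real.pi_pos
  set D : ℂ → ℝ := fun z => argSum t z - argSum s z with hD
  have hne : ∀ (u : Multiset ℝ) (z : ℂ), 0 < z.im → 0 < ‖(u.map fun a : ℝ => z - a).prod‖ := by
    intro u z hz
    rw [norm_pos_iff]
    refine Multiset.prod_ne_zero fun h => ?_
    obtain ⟨a, -, ha⟩ := Multiset.mem_map.1 h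
    have := congrArg Complex.im ha
    simp at this
    exact hz.ne' this
  have hsin : ∀ z : ℂ, 0 < z.im → 0 ≤ Real.sin (D z) := by
    intro z hz
    have h := H z hz
    rw [prod_sub_eq_norm_mul_exp s, prod_sub_eq_norm_mul_exp t] at h
    have hs0 := hne s z hz
    have ht0 := hne t z hz
    generalize ‖(s.map fun a : ℝ => z - a).prod‖ = R at h hs0
    generalize ‖(t.map fun a : ℝ => z - a).prod‖ = T at h ht0
    have e : (R * Complex.exp (argSum s z * Complex.I) *
        starRingEnd ℂ (T * Complex.exp (argSum t z * Complex.I))).im =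
        -(R * T * Real.sin (D z)) := by
      rw [hD, Real.sin_sub]
      simp only [map_mul, Complex.conj_ofReal, Complex.mul_im, Complex.mul_re, Complex.ofReal_re,
        Complex.ofReal_im, Complex.conj_re, Complex.conj_im, Complex.exp_ofReal_mul_I_re,
        Complex.exp_ofReal_mul_I_im]
      ring
    rw [e] at h
    have hRT : 0 < R * T := mul_pos hs0 ht0
    by_contra hc
    have := mul_neg_of_pos_of_neg hRT (not_le.1 hc)
    linarith
  have hlim : ∀ {x : ℝ}, x ∉ s → x ∉ t →
      Filter.Tendsto (fun y : ℝ => D ((x : ℂ) + y * Complex.I)) (nhdsWithin 0 (Set.Ioi 0))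
      (nhds (Real.pi * (t.countP (x < ·) : ℕ) - Real.pi * (s.countP (x < ·) : ℕ))) :=
    fun h1 h2 => (tendsto_argSum h2).sub (tendsto_argSum h1)
  have hpath : ∀ (x : ℝ), ∀ᶠ y : ℝ in nhdsWithin 0 (Set.Ioi 0),
      0 < ((x : ℂ) + y * Complex.I).im := by
    intro x
    filter_upwards [self_mem_nhdsWithin] with y hy
    simpa using hy
  -- Just above a real point to the right of all roots, both argument sums are near 0.
  obtain ⟨z₀, hz₀, h₀⟩ : ∃ z : ℂ, 0 < z.im ∧ |D z| < Real.pi / 2 := by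
    obtain ⟨M, hM⟩ := (s + t).toFinset.exists_le
    have hM' : ∀ a ∈ s + t, a < M + 1 := fun a ha =>
      lt_of_le_of_lt (hM a (Multiset.mem_toFinset.2 ha)) (by linarith)
    have h1 : ∀ a ∈ s, a < M + 1 := fun a ha => hM' a (Multiset.mem_add.2 (Or.inl ha))
    have h2 : ∀ a ∈ t, a < M + 1 := fun a ha => hM' a (Multiset.mem_add.2 (Or.inr ha))
    have h := hlim (x := M + 1) (fun h => (h1 _ h).false) (fun h => (h2 _ h).false)
    rw [Multiset.countP_eq_zero.2 fun a ha => not_lt.2 (h1 a ha).le,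
      Multiset.countP_eq_zero.2 fun a ha => not_lt.2 (h2 a ha).le] at h
    simp only [Nat.cast_zero, mul_zero, sub_zero] at h
    have h3 := h.abs.eventually (gt_mem_nhds (show |(0 : ℝ)| < Real.pi / 2 by simpa using hpi))
    obtain ⟨y, hy1, hy2⟩ := (h3.and (hpath (M + 1))).exists
    exact ⟨_, hy2, hy1⟩
  have hconn : IsPreconnected {z : ℂ | 0 < z.im} := (convex_halfSpace_im_gt 0).isPreconnected
  have hcont : ContinuousOn D {z : ℂ | 0 < z.im} :=
    (continuousOn_argSum t).sub (continuousOn_argSum s)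
  obtain ⟨h₀l, h₀u⟩ := abs_lt.1 h₀
  -- To leave `[0, π]`, `D` would have to pass through `-π/2` or `3π/2`, where the sine is `-1`.
  have hbound : ∀ z : ℂ, 0 < z.im → 0 ≤ D z ∧ D z ≤ Real.pi := by
    intro z hz
    have hsz := hsin z hz
    constructor
    · by_contra! hc
      have h1 : D z ≤ -Real.pi := by
        by_contra! h
        exact absurd (Real.sin_neg_of_neg_of_neg_pi_lt hc h) (not_lt.2 hsz)
      obtain ⟨w, hw, hw'⟩ := hconn.intermediate_value hz hz₀ hcont
        (show -(Real.pi / 2) ∈ Set.Icc (D z) (D z₀) from ⟨by linarith, by linarith⟩)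
      have := hsin w hw
      rw [hw', Real.sin_neg, Real.sin_pi_div_two] at this
      linarith
    · by_contra! hc
      have h1 : 2 * Real.pi ≤ D z := by
        by_contra! h
        have := Real.sin_neg_of_neg_of_neg_pi_lt (x := D z - 2 * Real.pi) (by linarith)
          (by linarith)
        rw [Real.sin_sub_two_pi] at this
        exact absurd this (not_lt.2 hsz)
      obtain ⟨w, hw, hw'⟩ := hconn.intermediate_value hz₀ hz hcont
        (show Real.pi / 2 + Real.pi ∈ Set.Icc (D z₀) (D z) from ⟨by linarith, by linarith⟩)
      have := hsin w hw
      rw [hw', Real.sin_add_pi, Real.sin_pi_div_two] at this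
      linarith
  have hx := hlim hs ht
  have hl := ge_of_tendsto hx ((hpath x).mono fun y hy => (hbound _ hy).1)
  have hu := le_of_tendsto hx ((hpath x).mono fun y hy => (hbound _ hy).2)
  constructor
  · have : ((s.countP (x < ·) : ℕ) : ℝ) ≤ (t.countP (x < ·) : ℕ) := by
      refine le_of_mul_le_mul_left ?_ hpi
      linarith
    exact_mod_cast this
  · have : ((t.countP (x < ·) : ℕ) : ℝ) ≤ (s.countP (x < ·) : ℕ) + 1 := by
      refine le_of_mul_le_mul_left ?_ hpi
      linarith
    exact_mod_cast this

/-! ### From root counts to interlacing of sorted lists. -/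

theorem lt_countP_of_lt_getElem {l : List ℝ} (hl : l.Pairwise (· ≥ ·)) {k : ℕ} (hk : k < l.length)
    {x : ℝ} (hx : x < l[k]) : k < l.countP (x < ·) := by
  have h1 : (l.take (k + 1)).countP (x < ·) = (l.take (k + 1)).length := by
    rw [List.countP_eq_length]
    intro a ha
    obtain ⟨i, hi, rfl⟩ := List.mem_take_iff_getElem.1 ha
    have : l[k] ≤ l[i] := by
      rcases (show i ≤ k by omega).eq_or_lt with rfl | h
      · exact le_rfl
      · exact List.pairwise_iff_getElem.1 hl i k _ hk h
    simpa using hx.trans_le this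
  have h2 := (List.take_sublist (k + 1) l).countP_le (p := (x < ·))
  rw [h1, List.length_take] at h2
  omega

theorem countP_le_of_getElem_lt {l : List ℝ} (hl : l.Pairwise (· ≥ ·)) {k : ℕ} (hk : k < l.length)
    {x : ℝ} (hx : l[k] < x) : l.countP (x < ·) ≤ k := by
  have h1 : (l.drop k).countP (x < ·) = 0 := by
    rw [List.countP_eq_zero]
    intro a ha
    obtain ⟨i, hi, rfl⟩ := List.mem_drop_iff_getElem.1 ha
    have : l[k + i] ≤ l[k] := by
      rcases Nat.eq_zero_or_pos i with rfl | h
      · exact le_rfl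
      · exact List.pairwise_iff_getElem.1 hl k (k + i) hk (by omega) (by omega)
    simpa using (this.trans_lt hx).le
  have h2 : l.countP (x < ·) = (l.take k).countP (x < ·) + (l.drop k).countP (x < ·) := by
    rw [← List.countP_append, List.take_append_drop]
  have h3 : (l.take k).countP (x < ·) ≤ (l.take k).length := List.countP_le_length
  rw [List.length_take] at h3
  omega

theorem rootsDesc_pairwise (f : ℝ[X]) : (rootsDesc f).Pairwise (· ≥ ·) :=
  Multiset.pairwise_sort _ _

theorem countP_rootsDesc (f : ℝ[X]) (x : ℝ) :
    (rootsDesc f).countP (x < ·) = f.roots.countP (x < ·) := by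
  conv_rhs => rw [← Multiset.sort_eq f.roots (· ≥ ·)]
  exact (Multiset.coe_countP _ _).symm

theorem aeval_eq_prod_roots {f : ℝ[X]} (hf : RealRooted f) (z : ℂ) :
    aeval z f = f.leadingCoeff * (f.roots.map fun a : ℝ => z - a).prod := by
  conv_lhs => rw [Splits.eq_prod_roots hf]
  rw [map_mul, aeval_C, map_multiset_prod, Multiset.map_map]
  simp

theorem interlaces_of_im_nonpos {f g : ℝ[X]} (hf : RealRooted f) (hg : RealRooted g)
    (hf0 : 0 < f.leadingCoeff) (hg0 : 0 < g.leadingCoeff)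
    (H : ∀ z : ℂ, 0 < z.im → (aeval z f * starRingEnd ℂ (aeval z g)).im ≤ 0) :
    Interlaces f g := by
  have key : ∀ x : ℝ, x ∉ f.roots → x ∉ g.roots →
      (rootsDesc f).countP (x < ·) ≤ (rootsDesc g).countP (x < ·) ∧
      (rootsDesc g).countP (x < ·) ≤ (rootsDesc f).countP (x < ·) + 1 := by
    intro x hx hx'
    rw [countP_rootsDesc, countP_rootsDesc]
    refine countP_roots_of_im_nonpos (fun z hz => ?_) hx hx'
    have h := H z hz
    rw [aeval_eq_prod_roots hf, aeval_eq_prod_roots hg, map_mul, Complex.conj_ofReal,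
      mul_mul_mul_comm, ← Complex.ofReal_mul, Complex.im_ofReal_mul] at h
    by_contra! hc
    exact absurd (mul_pos (mul_pos hf0 hg0) hc) (not_lt.2 h)
  have hbetween : ∀ a b : ℝ, a < b → ∃ x, a < x ∧ x < b ∧ x ∉ f.roots ∧ x ∉ g.roots := by
    intro a b hab
    obtain ⟨x, hx, hx'⟩ := (Set.Ioo_infinite hab).exists_notMem_finset (f.roots + g.roots).toFinset
    rw [Multiset.mem_toFinset, Multiset.mem_add, not_or] at hx'
    exact ⟨x, hx.1, hx.2, hx'⟩
  refine ⟨hf, hg, Or.inr (Or.inr ⟨?_, ?_, ?_⟩)⟩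
  -- Below all roots the counts are the full numbers of roots.
  · obtain ⟨M, hM⟩ := (f.roots + g.roots).toFinset.bddBelow
    have hM' : ∀ a ∈ f.roots + g.roots, M - 1 < a := fun a ha =>
      lt_of_lt_of_le (sub_one_lt M) (hM (Multiset.mem_toFinset.2 ha))
    have h1 : ∀ a ∈ f.roots, M - 1 < a := fun a ha => hM' a (Multiset.mem_add.2 (Or.inl ha))
    have h2 : ∀ a ∈ g.roots, M - 1 < a := fun a ha => hM' a (Multiset.mem_add.2 (Or.inr ha))
    have h := key (M - 1) (fun h => (h1 _ h).false) (fun h => (h2 _ h).false)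
    rw [countP_rootsDesc, countP_rootsDesc, Multiset.countP_eq_card.2 h1,
      Multiset.countP_eq_card.2 h2] at h
    simp only [rootsDesc, Multiset.length_sort]
    omega
  -- A violated inequality leaves a gap; a non-root `x` inside it contradicts the count comparison.
  · intro k hkf hkg
    by_contra! hc
    obtain ⟨x, h1, h2, h3, h4⟩ := hbetween _ _ hc
    have := key x h3 h4
    have := lt_countP_of_lt_getElem (rootsDesc_pairwise f) hkf h2
    have := countP_le_of_getElem_lt (rootsDesc_pairwise g) hkg h1
    omega
  · intro k hkf hkg
    by_contra! hc
    obtain ⟨x, h1, h2, h3, h4⟩ := hbetween _ _ hc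
    have := key x h3 h4
    have := lt_countP_of_lt_getElem (rootsDesc_pairwise g) hkg h2
    have := countP_le_of_getElem_lt (rootsDesc_pairwise f) hkf h1
    omega


theorem mainTheorem10 (h : ℝ[X]) :
    (∀ r d i : ℕ, i < r →
      aPoly h (d + 1) r i =
        ∑ j ∈ Finset.range (i + 1), aPoly h d r j +
          ∑ j ∈ Finset.Ico (i + 1) r, X * aPoly h d r j) ∧
    ((∀ n : ℕ, 0 ≤ h.coeff n) →
      ∀ r d : ℕ, 1 ≤ r → h.natDegree ≤ r →
        IsInterlacingSequence (fun k : Fin r => aPoly h d r (r - 1 - (k : ℕ)))) := by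
  refine ⟨fun r d i hi => aPoly_succ h hi, fun hh r d hr1 hr k l hkl => ?_⟩
  have hkl' : (k : ℕ) ≤ l := hkl
  have hrr : ∀ i < r, RealRooted (aPoly h d r i) := by
    intro i hi
    by_cases h0 : aPoly h d r i = 0
    · rw [h0]; exact Splits.zero
    · exact realRooted_of_aeval_ne_zero h0 fun z hz =>
        (aPoly_eq_zero_or_aeval_ne_zero hh hr hz d i hi).resolve_left h0
  have hlc : ∀ i, aPoly h d r i ≠ 0 → 0 < (aPoly h d r i).leadingCoeff := fun i hi =>
    lt_of_le_of_ne (coeff_aPoly_nonneg hh hr1 d i _) (Ne.symm (leadingCoeff_ne_zero.2 hi))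
  by_cases hk0 : aPoly h d r (r - 1 - (k : ℕ)) = 0
  · exact ⟨hrr _ (by omega), hrr _ (by omega), Or.inl hk0⟩
  by_cases hl0 : aPoly h d r (r - 1 - (l : ℕ)) = 0
  · exact ⟨hrr _ (by omega), hrr _ (by omega), Or.inr (Or.inl hl0)⟩
  exact interlaces_of_im_nonpos (hrr _ (by omega)) (hrr _ (by omega)) (hlc _ hk0) (hlc _ hl0)
    fun z hz => (argBetween_aPoly hh hr hz d _ _ (by omega) (by omega)).1
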